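/- Let $\Omega$ be a locally compact Hausdorff space with countable base, let $\mathcal M^+(\Omega)$ be the class of nonnegative (locally finite) Radon measures on $\Omega$, let $\mu,\sigma\in\mathcal M^+(\Omega)$ with $\sigma\neq 0$, and let $0<q<1$. Let $G:\Omega\times\Omega\to(0,+\infty]$ be a lower semicontinuous kernel that is quasi-metric, i.e. $G(x,y)=G(y,x)$ for all $x,y\in\Omega$ and there is a constant $\kappa>0$ such that $d:=1/G$ (with $1/\infty=0$) satisfies $d(x,y)\le\kappa\,[d(x,z)+d(z,y)]$ for all $x,y,z\in\Omega$. Write $\mathbf G\nu(x)=\int_\Omega G(x,y)\,d\nu(y)$. Fix $x_0\in\Omega$ and suppose that $g(x)=\min\{1,G(x,x_0)\}$ is continuous on $\Omega$. A nontrivial supersolution of the equation $u=\mathbf G(u^q\,d\sigma)+\mathbf G\mu$ is a Borel function $u:\Omega\to[0,+\infty]$ such that $u>0$ and $\mathbf G(u^q\,d\sigma)+\mathbf G\mu\le u<+\infty$ $d\sigma$-a.e.; a nontrivial solution is a nontrivial supersolution that also satisfies $u\le\mathbf G(u^q\,d\sigma)+\mathbf G\mu<+\infty$ $d\sigma$-a.e.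 Then the following are equivalent: 1. a nontrivial supersolution exists; 2. a nontrivial solution exists; 3. $\int_\Omega g\,d\mu<\infty$ and $\tilde\varkappa(\Omega)<\infty$, where $\tilde\varkappa(\Omega)\in[0,+\infty]$ is the least constant $C$ in the inequality $$\|\mathbf G\nu\|_{L^q(\Omega,\,g\,d\sigma)}=\Big(\int_\Omega(\mathbf G\nu)^q\,g\,d\sigma\Big)^{1/q}\le C\int_\Omega g\,d\nu\qquad\text{for all }\nu\in\mathcal M^+(\Omega).$$ -/

import Mathlib

open MeasureTheory
open scoped ENNReal NNReal

namespace Sublinear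

/-- A kernel in the sense of potential theory: a lower semicontinuous function
`G : Ω × Ω → (0, +∞]`. -/
structure IsKernel {Ω : Type*} [TopologicalSpace Ω] (G : Ω → Ω → ℝ≥0∞) : Prop where
  pos : ∀ x y, 0 < G x y
  lsc : LowerSemicontinuous (fun p : Ω × Ω => G p.1 p.2)

/-- `G` is quasi-metric: it is symmetric and `d(x, y) = 1 / G(x, y)` (with `1 / ∞ = 0`) satisfies
`d(x, y) ≤ κ (d(x, z) + d(z, y))` for some constant `κ > 0`. -/
def IsQuasiMetric {Ω : Type*} (G : Ω → Ω → ℝ≥0∞) : Prop :=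
  (∀ x y, G x y = G y x) ∧
    ∃ κ : ℝ≥0, 0 < κ ∧ ∀ x y z, (G x y)⁻¹ ≤ (κ : ℝ≥0∞) * ((G x z)⁻¹ + (G z y)⁻¹)

/-- The potential `Gν(x) = ∫ G(x, y) dν(y)`. -/
noncomputable def potential {Ω : Type*} [MeasurableSpace Ω] (G : Ω → Ω → ℝ≥0∞)
    (ν : Measure Ω) (x : Ω) : ℝ≥0∞ :=
  ∫⁻ y, G x y ∂ν

/-- The right-hand side `G(u^q dσ) + Gμ` of the integral equation. -/
noncomputable def rhs {Ω : Type*} [MeasurableSpace Ω] (G : Ω → Ω → ℝ≥0∞) (q : ℝ)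
    (σ μ : Measure Ω) (u : Ω → ℝ≥0∞) (x : Ω) : ℝ≥0∞ :=
  potential G (σ.withDensity (fun y => u y ^ q)) x + potential G μ x

/-- Nontrivial supersolution: a Borel function `u : Ω → [0, ∞]` with `u > 0` and
`G(u^q dσ) + Gμ ≤ u < ∞`, both `σ`-a.e. -/
structure IsNontrivialSupersolution {Ω : Type*} [MeasurableSpace Ω] (G : Ω → Ω → ℝ≥0∞) (q : ℝ)
    (σ μ : Measure Ω) (u : Ω → ℝ≥0∞) : Prop where
  measurable : Measurable u
  pos : ∀ᵐ x ∂σ, 0 < u x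
  rhs_le : ∀ᵐ x ∂σ, rhs G q σ μ u x ≤ u x
  lt_top : ∀ᵐ x ∂σ, u x < ∞

/-- Subsolution: a Borel function `u : Ω → [0, ∞]` with `u ≤ G(u^q dσ) + Gμ < ∞`, `σ`-a.e. -/
structure IsSubsolution {Ω : Type*} [MeasurableSpace Ω] (G : Ω → Ω → ℝ≥0∞) (q : ℝ)
    (σ μ : Measure Ω) (u : Ω → ℝ≥0∞) : Prop where
  measurable : Measurable u
  le_rhs : ∀ᵐ x ∂σ, u x ≤ rhs G q σ μ u x
  rhs_lt_top : ∀ᵐ x ∂σ, rhs G q σ μ u x < ∞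

/-- Nontrivial solution of `u = G(u^q dσ) + Gμ`: a subsolution that is also a nontrivial
supersolution. -/
def IsNontrivialSolution {Ω : Type*} [MeasurableSpace Ω] (G : Ω → Ω → ℝ≥0∞) (q : ℝ)
    (σ μ : Measure Ω) (u : Ω → ℝ≥0∞) : Prop :=
  IsSubsolution G q σ μ u ∧ IsNontrivialSupersolution G q σ μ u

/-- The modifier `g(x) = min {1, G(x, x₀)}` with pole `x₀`. -/
noncomputable def modifier {Ω : Type*} (G : Ω → Ω → ℝ≥0∞) (x₀ x : Ω) : ℝ≥0∞ :=
  min 1 (G x x₀)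

/-- The least constant `C ∈ [0, ∞]` in the weighted norm inequality
`‖Gν‖_{L^q(m dσ)} ≤ C ∫ m dν`, for all locally finite Borel measures `ν`. On a locally compact
Hausdorff space with countable base these are exactly the nonnegative Radon measures. -/
noncomputable def leastConstant {Ω : Type*} [TopologicalSpace Ω] [MeasurableSpace Ω]
    (G : Ω → Ω → ℝ≥0∞) (q : ℝ) (σ : Measure Ω) (m : Ω → ℝ≥0∞) : ℝ≥0∞ :=
  sInf {C : ℝ≥0∞ | ∀ ν : Measure Ω, IsLocallyFiniteMeasure ν →
    eLpNorm (potential G ν) (ENNReal.ofReal q) (σ.withDensity m) ≤ C * ∫⁻ y, m y ∂ν}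

end Sublinear

/-! ### Weak-type estimates for the kernel `1 / ρ` by Vitali covering -/

namespace Sublinear

/-! Necessity. Let `u` be a supersolution, put `τ = u ^ q σ` and write g for the modifier.
Potentials are finite at some point, and g is dominated there by a multiple of the kernel, so g is
integrable against both `τ` and `μ`. The function d(x, y) g(x) g(y) is again a quasi-metric
(`modifiedDist_le`), and its balls are open because g is continuous (`isOpen_modifiedDist_lt`). A
Vitali covering then shows that Gν / Gτ is of weak type (1, 1) for the finite measure g dτ, with
bound B ∫ g dν (`exists_weak_type_potential_le`). Since Gτ ≤ u almost everywhere, Gν / u obeys the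
same bound. Kolmogorov's inequality turns it into an L^q bound, in which the u^q of dτ cancels the
denominator; what remains is the weighted norm inequality.

Sufficiency. A small multiple of the indicator of a compact set is a subsolution. Iterating the
right-hand side from it gives an increasing sequence. The weighted norm inequality bounds J, the
integral of v^q g dσ, at each step by K J^q + B, with J taken at the previous step; as q < 1, all
these integrals stay below one constant. The supremum solves the equation and is finite almost
everywhere since g > 0. -/

/-- Comparing the distribution functions of `f` under `ν` and of a multiple of `f` under `ω`
compares the integrals. -/
theorem lintegral_le_of_measure_lt_le {α : Type*} [MeasurableSpace α] {ν ω : Measure α}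
    {f : α → ℝ≥0∞} (hf : Measurable f) {c A : ℝ≥0∞}
    (h : ∀ s : ℝ≥0, 0 < s → ν {y | (s : ℝ≥0∞) < f y} ≤ c * ω {y | (s : ℝ≥0∞) < A * f y}) :
    ∫⁻ y, f y ∂ν ≤ c * (A * ∫⁻ y, f y ∂ω) := by
  -- The layer-cake formula is real-valued, so `f` is truncated. The same level `n` cuts off `A *
  -- f`, so for `t ≥ n` both superlevel sets are empty and for `t < n` they are those in `h`.
  have hsup : ∀ y, f y = ⨆ n : ℕ, min (f y) n := fun y => by
    rw [← inf_iSup_eq, ENNReal.iSup_natCast, inf_top_eq]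
  have hlayer : ∀ (n : ℕ) (τ : Measure α) (e : α → ℝ≥0∞), Measurable e →
      ∫⁻ y, min (e y) n ∂τ =
        ∫⁻ t in Set.Ioi (0 : ℝ), τ {y | ENNReal.ofReal t < min (e y) n} := by
    intro n τ e he
    have hfin : ∀ y, min (e y) n ≠ ∞ := fun y =>
      ne_top_of_le_ne_top (ENNReal.natCast_ne_top n) (min_le_right _ _)
    have h1 := lintegral_eq_lintegral_meas_lt (f := fun y => (min (e y) n).toReal) τ
      (Filter.Eventually.of_forall fun _ => ENNReal.toReal_nonneg)
      (he.min measurable_const).ennreal_toReal.aemeasurable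
    simp only [ENNReal.ofReal_toReal (hfin _)] at h1
    rw [h1]
    refine setLIntegral_congr_fun measurableSet_Ioi fun t ht => ?_
    congr 1
    ext y
    exact (ENNReal.ofReal_lt_iff_lt_toReal (le_of_lt ht) (hfin y)).symm
  calc ∫⁻ y, f y ∂ν = ∫⁻ y, ⨆ n : ℕ, min (f y) n ∂ν := lintegral_congr hsup
    _ = ⨆ n : ℕ, ∫⁻ y, min (f y) n ∂ν := by
        refine lintegral_iSup (fun n => hf.min measurable_const) fun m n hmn y => ?_
        exact min_le_min_left _ (Nat.cast_le.2 hmn)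
    _ ≤ c * (A * ∫⁻ y, f y ∂ω) := iSup_le fun n => ?_
  rw [hlayer n ν f hf]
  calc _ ≤ ∫⁻ t in Set.Ioi (0 : ℝ), c * ω {y | ENNReal.ofReal t < min (A * f y) n} := by
        refine setLIntegral_mono' measurableSet_Ioi fun t ht => ?_
        simp only [lt_min_iff]
        by_cases htn : ENNReal.ofReal t < n
        · simp only [htn, and_true]
          exact h t.toNNReal (Real.toNNReal_pos.2 ht)
        · simp [htn]
    _ = c * ∫⁻ y, min (A * f y) n ∂ω := by
        rw [hlayer n ω _ (hf.const_mul A), lintegral_const_mul]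
        exact Antitone.measurable fun s t hst => measure_mono fun y hy =>
          lt_of_le_of_lt (ENNReal.ofReal_le_ofReal hst) hy
    _ ≤ c * ∫⁻ y, A * f y ∂ω := by gcongr; exact min_le_left _ _
    _ = c * (A * ∫⁻ y, f y ∂ω) := by rw [lintegral_const_mul _ hf]

/-- A finite Vitali covering argument: if every `x ∈ E` has a ball whose `ν`-mass dominates the
`ω`-mass of an enlarged ball, then the total `ν`-mass dominates `ω E`. -/
theorem measure_le_of_forall_exists_ball {Ω : Type*} [TopologicalSpace Ω] [MeasurableSpace Ω]
    [BorelSpace Ω] {ρ : Ω → Ω → ℝ≥0∞} (hsymm : ∀ x y, ρ x y = ρ y x) {A : ℝ≥0} (hA : 1 ≤ A)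
    (htri : ∀ x y z, ρ x y ≤ A * max (ρ x z) (ρ z y))
    (hopen : ∀ x (r : ℝ≥0), IsOpen {y | ρ x y < r})
    {ν ω : Measure Ω} [ω.Regular] {c : ℝ≥0∞} {E : Set Ω}
    (h : ∀ x ∈ E, ∃ r : ℝ≥0, 0 < r ∧
      c * ω {y | ρ x y < (2 * A ^ 2 * r : ℝ≥0)} < ν {y | ρ x y < r}) :
    c * ω E ≤ ν Set.univ := by
  choose! r hr0 hr using h
  have hA' : (A : ℝ≥0∞) ≠ ∞ := ENNReal.coe_ne_top
  have hA0 : (A : ℝ≥0∞) ≠ 0 := by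
    simpa using (zero_lt_one.trans_le hA).ne'
  have hmul : ∀ {a b : ℝ≥0∞}, a < b → (A : ℝ≥0∞) * a < A * b := fun hab =>
    ENNReal.mul_lt_mul_right hA0 hA' hab
  -- `ρ x x` may be positive, so `x` need not lie in its own ball. That ball is nonempty because its
  -- `ν`-mass is positive, and enlarging the radius by `A` then captures the centre.
  set U : Set Ω := ⋃ x : E, {y | ρ x y < (A * r x : ℝ≥0)} with hU
  have hne : ∀ x ∈ E, {y | ρ x y < r x}.Nonempty := fun x hx => by
    by_contra hcon
    have := hr x hx
    rw [Set.not_nonempty_iff_eq_empty.1 hcon] at this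
    simp at this
  have hEU : E ⊆ U := fun x hx => by
    obtain ⟨z, hz⟩ := hne x hx
    refine Set.mem_iUnion.2 ⟨⟨x, hx⟩, ?_⟩
    calc ρ x x ≤ A * max (ρ x z) (ρ z x) := htri x x z
      _ = A * ρ x z := by rw [hsymm z x, max_self]
      _ < A * r x := hmul hz
      _ = (A * r x : ℝ≥0) := by push_cast; rfl
  have hUo : IsOpen U := isOpen_iUnion fun x => hopen x _
  suffices hK : ∀ K ⊆ U, IsCompact K → c * ω K ≤ ν Set.univ by
    calc c * ω E ≤ c * ω U := by gcongr
      _ ≤ ν Set.univ := by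
        rw [hUo.measure_eq_iSup_isCompact]
        simp only [ENNReal.mul_iSup]
        exact iSup_le fun K => iSup_le fun hKU => iSup_le fun hKc => hK K hKU hKc
  intro K hKU hKc
  obtain ⟨t, ht⟩ := hKc.elim_finite_subcover _ (fun x : E => hopen x (A * r x)) hKU
  obtain ⟨R, hR⟩ : ∃ R : ℝ, ∀ a ∈ (t : Set E), (r a : ℝ) ≤ R := by
    obtain ⟨R, hR⟩ := ((t.finite_toSet.image fun a : E => (r a : ℝ))).bddAbove
    exact ⟨R, fun a ha => hR (Set.mem_image_of_mem _ ha)⟩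
  -- Disjoint balls with `r a ≤ 2 * r b` whenever the ball of `a` meets the selected ball of `b`.
  -- Two uses of the quasi-triangle inequality contribute the factor `A ^ 2`.
  obtain ⟨u, hut, hdisj, hcov⟩ := Vitali.exists_disjoint_subfamily_covering_enlargement
    (fun x : E => {y | ρ x y < r x}) (t : Set E) (fun x => (r x : ℝ)) 2 one_lt_two
    (fun a _ => (r a).2) R hR (fun a _ => hne a a.2)
  have hufin : u.Finite := t.finite_toSet.subset hut
  have hKu : K ⊆ ⋃ b ∈ hufin.toFinset, {y | ρ (b : E) y < (2 * A ^ 2 * r b : ℝ≥0)} := by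
    intro y hy
    obtain ⟨a, hat, hay⟩ := Set.mem_iUnion₂.1 (ht hy)
    obtain ⟨b, hbu, ⟨z, hza, hzb⟩, hrab⟩ := hcov a hat
    have hrab' : r a ≤ 2 * r b := by exact_mod_cast hrab
    refine Set.mem_iUnion₂.2 ⟨b, by simpa using hbu, ?_⟩
    simp only [Set.mem_ofPred_eq] at hza hzb hay ⊢
    have h2 : (r a : ℝ≥0∞) ≤ (2 * r b : ℝ≥0) := by exact_mod_cast hrab'
    have hrb : (r b : ℝ≥0∞) ≤ (2 * r b : ℝ≥0) := by
      exact_mod_cast le_mul_of_one_le_left zero_le one_le_two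
    have hba : ρ b a < A * (2 * r b : ℝ≥0) := by
      refine (htri b a z).trans_lt (hmul (max_lt ?_ ?_))
      · exact hzb.trans_le hrb
      · rw [hsymm z a]
        exact hza.trans_le h2
    have hay' : ρ a y < A * (2 * r b : ℝ≥0) := by
      refine hay.trans_le ?_
      push_cast at h2 ⊢
      gcongr
    calc ρ b y ≤ A * max (ρ b a) (ρ a y) := htri b y a
      _ < A * (A * (2 * r b : ℝ≥0)) := hmul (max_lt hba hay')
      _ = (2 * A ^ 2 * r b : ℝ≥0) := by push_cast; ring
  calc c * ω K ≤ c * ∑ b ∈ hufin.toFinset, ω {y | ρ (b : E) y < (2 * A ^ 2 * r b : ℝ≥0)} := by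
        gcongr
        exact (measure_mono hKu).trans (measure_biUnion_finset_le _ _)
    _ = ∑ b ∈ hufin.toFinset, c * ω {y | ρ (b : E) y < (2 * A ^ 2 * r b : ℝ≥0)} :=
        Finset.mul_sum _ _ _
    _ ≤ ∑ b ∈ hufin.toFinset, ν {y | ρ (b : E) y < r b} :=
        Finset.sum_le_sum fun b _ => (hr b b.2).le
    _ = ν (⋃ b ∈ hufin.toFinset, {y | ρ (b : E) y < r b}) := by
        refine (measure_biUnion_finset (f := fun b : E => {y | ρ b y < r b}) ?_
          fun b _ => (hopen b _).measurableSet).symm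
        simpa using hdisj
    _ ≤ ν Set.univ := measure_mono (Set.subset_univ _)

/-- Weak-type `(1, 1)` estimate for quotients of potentials of the kernel `1 / ρ`, where `ρ` is a
quasi-metric with open balls. -/
theorem measure_lt_potential_le {Ω : Type*} [TopologicalSpace Ω] [MeasurableSpace Ω]
    [BorelSpace Ω] {ρ : Ω → Ω → ℝ≥0∞} (hsymm : ∀ x y, ρ x y = ρ y x) {A : ℝ≥0} (hA : 1 ≤ A)
    (htri : ∀ x y z, ρ x y ≤ A * max (ρ x z) (ρ z y))
    (hopen : ∀ x (r : ℝ≥0), IsOpen {y | ρ x y < r})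
    {ν ω : Measure Ω} [ω.Regular] (c : ℝ≥0∞) :
    c * ω {x | c * ((2 * A ^ 2 : ℝ≥0) * ∫⁻ y, (ρ x y)⁻¹ ∂ω) < ∫⁻ y, (ρ x y)⁻¹ ∂ν} ≤
      ν Set.univ := by
  refine measure_le_of_forall_exists_ball hsymm hA htri hopen fun x hx => ?_
  -- If every ball at `x` fails the mass comparison, integrating over the levels `s = 1 / r` bounds
  -- the potential of `ν` at `x` by that of `ω`, contradicting the choice of `x`.
  by_contra! hcon
  rw [Set.mem_ofPred_eq] at hx
  refine (not_lt_of_ge ?_) hx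
  have hmeas : Measurable fun y => (ρ x y)⁻¹ := by
    refine Measurable.inv (measurable_of_Iio fun a => ?_)
    induction a with
    | top =>
      have : (fun y => ρ x y) ⁻¹' Set.Iio ∞ = ⋃ n : ℕ, {y | ρ x y < ((n : ℝ≥0) : ℝ≥0∞)} := by
        ext y
        simp only [Set.mem_preimage, Set.mem_Iio, Set.mem_iUnion, Set.mem_ofPred_eq]
        refine ⟨fun h => ?_, fun ⟨n, hn⟩ => hn.trans ENNReal.coe_lt_top⟩
        obtain ⟨n, hn⟩ := ENNReal.exists_nat_gt h.ne
        exact ⟨n, by simpa using hn⟩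
      rw [this]
      exact MeasurableSet.iUnion fun n => (hopen x n).measurableSet
    | coe r => exact (hopen x r).measurableSet
  refine lintegral_le_of_measure_lt_le hmeas fun s hs => ?_
  have hleft : ∀ y, (s : ℝ≥0∞) < (ρ x y)⁻¹ ↔ ρ x y < (s⁻¹ : ℝ≥0) := fun y => by
    rw [ENNReal.coe_inv hs.ne', ENNReal.lt_inv_iff_lt_inv]
  have hright : ∀ y, (s : ℝ≥0∞) < (2 * A ^ 2 : ℝ≥0) * (ρ x y)⁻¹ ↔
      ρ x y < (2 * A ^ 2 * s⁻¹ : ℝ≥0) := fun y => by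
    have hs' : (s : ℝ≥0∞) ≠ 0 := by simpa using hs.ne'
    rw [ENNReal.coe_mul (2 * A ^ 2), ENNReal.coe_inv hs.ne', ← div_eq_mul_inv, ← div_eq_mul_inv,
      ENNReal.lt_div_iff_mul_lt (b := s) (Or.inl hs') (Or.inl ENNReal.coe_ne_top),
      ENNReal.lt_div_iff_mul_lt (Or.inr ENNReal.coe_ne_top) (Or.inr hs'), mul_comm]
  simp only [hleft, hright]
  exact hcon s⁻¹ (inv_pos.2 hs)

end Sublinear

/-! ### Kolmogorov's inequality -/

namespace Sublinear

/-- Kolmogorov's inequality: a weak-type bound on a finite measure space gives an `L^q` bound for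
`0 < q < 1`. -/
theorem lintegral_rpow_le_of_weak_type {α : Type*} [MeasurableSpace α] {ω : Measure α}
    {F : α → ℝ≥0∞} (hF : Measurable F) {q : ℝ} (hq : 0 < q) {M : ℝ≥0∞} (hM0 : M ≠ 0)
    (hM : M ≠ ∞) (h : ∀ t : ℝ≥0∞, t * ω {x | t < F x} ≤ M) :
    ∫⁻ x, F x ^ q ∂ω ≤ M ^ q * (ω Set.univ + 2 ^ q * (1 - 2 ^ (q - 1))⁻¹) := by
  -- Dyadic decomposition above level `M`: a finite value lies in a single layer, while at `F x = ∞`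
  -- every term is at least `M ^ q` and the series diverges.
  have hpt : ∀ x, F x ^ q ≤ M ^ q + ∑' k : ℕ,
      {x | M * 2 ^ k < F x}.indicator (fun _ => (M * 2 ^ (k + 1)) ^ q) x := by
    intro x
    rcases le_or_gt (F x) M with hx | hx
    · exact le_add_right (ENNReal.rpow_le_rpow hx hq.le)
    refine le_add_left ?_
    by_cases htop : F x = ∞
    · refine le_top.trans ?_
      rw [← ENNReal.tsum_const_eq_top_of_ne_zero (α := ℕ) (c := M ^ q)
        (by simp [hM0, hM])]
      refine ENNReal.tsum_le_tsum fun k => ?_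
      rw [Set.indicator_of_mem]
      · exact ENNReal.rpow_le_rpow (le_mul_of_one_le_right zero_le
          (one_le_pow₀ one_le_two)) hq.le
      · simp only [Set.mem_ofPred_eq, htop]
        exact ENNReal.mul_lt_top hM.lt_top (by simp)
    · have hex : ∃ n : ℕ, F x ≤ M * 2 ^ n := by
        obtain ⟨n, hn⟩ := ENNReal.exists_nat_gt (ENNReal.div_ne_top htop hM0)
        refine ⟨n, ?_⟩
        rw [mul_comm]
        refine (ENNReal.div_le_iff hM0 hM).1 (hn.le.trans ?_)
        exact_mod_cast Nat.lt_two_pow_self.le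
      classical
      obtain ⟨k, hk⟩ : ∃ k, Nat.find hex = k + 1 := by
        refine Nat.exists_eq_succ_of_ne_zero fun h0 => ?_
        have := Nat.find_spec hex
        rw [h0] at this
        simp only [pow_zero, mul_one] at this
        exact hx.not_ge this
      have h1 : F x ≤ M * 2 ^ (k + 1) := hk ▸ Nat.find_spec hex
      have h2 : M * 2 ^ k < F x := not_le.1 (Nat.find_min hex (by omega))
      refine le_trans ?_ (ENNReal.le_tsum k)
      rw [Set.indicator_of_mem (by exact h2)]
      exact ENNReal.rpow_le_rpow h1 hq.le
  have hset : ∀ k : ℕ, MeasurableSet {x | M * 2 ^ k < F x} := fun k =>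
    measurableSet_lt measurable_const hF
  have hterm : ∀ k : ℕ, (M * 2 ^ (k + 1)) ^ q * ω {x | M * 2 ^ k < F x} ≤
      M ^ q * (2 ^ q * (2 ^ (q - 1)) ^ k) := by
    intro k
    have hk0 : (2 : ℝ≥0∞) ^ k ≠ 0 := by positivity
    have hkt : (2 : ℝ≥0∞) ^ k ≠ ∞ := by simp
    have hw : ω {x | M * 2 ^ k < F x} ≤ (2 ^ k)⁻¹ := by
      rw [ENNReal.le_inv_iff_mul_le]
      refine (ENNReal.mul_le_mul_iff_right hM0 hM).1 ?_
      rw [mul_one]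
      calc M * (ω {x | M * 2 ^ k < F x} * 2 ^ k) = M * 2 ^ k * ω {x | M * 2 ^ k < F x} := by ring
        _ ≤ M := h _
    calc (M * 2 ^ (k + 1)) ^ q * ω {x | M * 2 ^ k < F x}
        ≤ (M * 2 ^ (k + 1)) ^ q * (2 ^ k)⁻¹ := by gcongr
      _ = M ^ q * (2 ^ q * (((2 : ℝ≥0∞) ^ k) ^ q * (2 ^ k)⁻¹)) := by
          rw [pow_succ, ENNReal.mul_rpow_of_nonneg _ _ hq.le, ENNReal.mul_rpow_of_nonneg _ _ hq.le]
          ring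
      _ = M ^ q * (2 ^ q * (2 ^ (q - 1)) ^ k) := by
          congr 2
          rw [← ENNReal.rpow_natCast, ← ENNReal.rpow_natCast, ← ENNReal.rpow_mul,
            ← ENNReal.rpow_neg, ← ENNReal.rpow_add _ _ two_ne_zero ENNReal.ofNat_ne_top,
            ← ENNReal.rpow_mul]
          congr 1
          ring
  calc ∫⁻ x, F x ^ q ∂ω ≤ ∫⁻ x, (M ^ q + ∑' k : ℕ,
        {x | M * 2 ^ k < F x}.indicator (fun _ => (M * 2 ^ (k + 1)) ^ q) x) ∂ω :=
        lintegral_mono hpt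
    _ = M ^ q * ω Set.univ + ∑' k : ℕ, (M * 2 ^ (k + 1)) ^ q * ω {x | M * 2 ^ k < F x} := by
        rw [lintegral_add_left measurable_const, lintegral_const,
          lintegral_tsum fun k => (measurable_const.indicator (hset k)).aemeasurable]
        simp only [lintegral_indicator_const (hset _)]
    _ ≤ M ^ q * ω Set.univ + ∑' k : ℕ, M ^ q * (2 ^ q * (2 ^ (q - 1)) ^ k) := by
        exact add_le_add le_rfl (ENNReal.tsum_le_tsum hterm)
    -- The geometric ratio is `2 ^ (q - 1)`. For `q ≥ 1` the truncated subtraction gives `0`, so the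
    -- constant is `∞` and the bound is empty.
    _ = M ^ q * (ω Set.univ + 2 ^ q * (1 - 2 ^ (q - 1))⁻¹) := by
        rw [ENNReal.tsum_mul_left, ENNReal.tsum_mul_left, ENNReal.tsum_geometric, mul_add]

/-! ### The modifier and the modified quasi-metric -/

theorem modifier_ne_zero {Ω : Type*} [TopologicalSpace Ω] {G : Ω → Ω → ℝ≥0∞} (hG : IsKernel G)
    (x₀ x : Ω) : modifier G x₀ x ≠ 0 :=
  (lt_min zero_lt_one (hG.pos x x₀)).ne'

theorem modifier_le_one {Ω : Type*} (G : Ω → Ω → ℝ≥0∞) (x₀ x : Ω) : modifier G x₀ x ≤ 1 :=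
  min_le_left _ _

theorem modifier_ne_top {Ω : Type*} (G : Ω → Ω → ℝ≥0∞) (x₀ x : Ω) : modifier G x₀ x ≠ ∞ :=
  ne_top_of_le_ne_top ENNReal.one_ne_top (modifier_le_one G x₀ x)

theorem inv_modifier {Ω : Type*} (G : Ω → Ω → ℝ≥0∞) (x₀ x : Ω) :
    (modifier G x₀ x)⁻¹ = max 1 (G x x₀)⁻¹ := by
  rw [modifier, ENNReal.inv_strictAnti.antitone.map_min, inv_one]

theorem IsQuasiMetric.exists_le_max {Ω : Type*} {G : Ω → Ω → ℝ≥0∞} (h : IsQuasiMetric G) :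
    ∃ A : ℝ≥0, 1 ≤ A ∧ ∀ x y z, (G x y)⁻¹ ≤ A * max (G x z)⁻¹ (G z y)⁻¹ := by
  obtain ⟨-, κ, -, hκ⟩ := h
  refine ⟨max 1 (2 * κ), le_max_left _ _, fun x y z => ?_⟩
  calc (G x y)⁻¹ ≤ κ * ((G x z)⁻¹ + (G z y)⁻¹) := hκ x y z
    _ ≤ κ * (max (G x z)⁻¹ (G z y)⁻¹ + max (G x z)⁻¹ (G z y)⁻¹) := by
        gcongr
        exacts [le_max_left _ _, le_max_right _ _]
    _ = (2 * κ : ℝ≥0) * max (G x z)⁻¹ (G z y)⁻¹ := by push_cast; ring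
    _ ≤ _ := by gcongr; exact le_max_right _ _

/-- The quasi-metric `g(x) g(y) d(x, y)` of the modified kernel `G(x, y) / (g(x) g(y))`. -/
noncomputable def modifiedDist {Ω : Type*} (G : Ω → Ω → ℝ≥0∞) (x₀ x y : Ω) : ℝ≥0∞ :=
  modifier G x₀ x * modifier G x₀ y * (G x y)⁻¹

theorem modifiedDist_comm {Ω : Type*} {G : Ω → Ω → ℝ≥0∞} (hsymm : ∀ x y, G x y = G y x)
    (x₀ x y : Ω) : modifiedDist G x₀ x y = modifiedDist G x₀ y x := by
  rw [modifiedDist, modifiedDist, hsymm x y, mul_comm (modifier G x₀ x)]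

/-- A Ptolemy-type inequality in which all distances are compared up to a factor `A`. -/
theorem mul_le_sq_mul_max {A a b c p r s : ℝ≥0∞} (ha : a ≤ A * max b c) (hpr : a ≤ A * max p r)
    (hsp : s ≤ A * max p b) (hsr : s ≤ A * max r c) : a * s ≤ A ^ 2 * max (b * r) (c * p) := by
  -- Think of six distances between four points, with opposite pairs `(a, s)`, `(b, r)`, `(c, p)`.
  -- Exchanging `b` and `c` exchanges `p` and `r` as well.
  wlog hbc : b ≤ c generalizing b c p r
  · rw [max_comm]
    exact this (max_comm b c ▸ ha) (max_comm p r ▸ hpr) hsr hsp (le_of_not_ge hbc)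
  rw [max_eq_right hbc] at ha
  rcases le_total b p with hbp | hpb
  · rw [max_eq_left hbp] at hsp
    calc a * s ≤ A * c * (A * p) := mul_le_mul' ha hsp
      _ = A ^ 2 * (c * p) := by ring
      _ ≤ _ := by gcongr; exact le_max_right _ _
  · rw [max_eq_right hpb] at hsp
    rcases le_total r p with hrp | hpr'
    · rw [max_eq_left hrp] at hpr
      calc a * s ≤ A * p * (A * b) := mul_le_mul' hpr hsp
        _ ≤ A * p * (A * c) := by gcongr
        _ = A ^ 2 * (c * p) := by ring
        _ ≤ _ := by gcongr; exact le_max_right _ _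
    · rw [max_eq_right hpr'] at hpr
      calc a * s ≤ A * r * (A * b) := mul_le_mul' hpr hsp
        _ = A ^ 2 * (b * r) := by ring
        _ ≤ _ := by gcongr; exact le_max_left _ _

/-- The reciprocal of the modifier, `max 1 (d x x₀)`, satisfies the inequalities of a distance to a
fourth point. The Ptolemy inequality for `x`, `y`, `z` and that point, divided by the three
distances to it, is the quasi-triangle inequality. -/
theorem modifiedDist_le {Ω : Type*} [TopologicalSpace Ω] {G : Ω → Ω → ℝ≥0∞} (hG : IsKernel G)
    (hsymm : ∀ x y, G x y = G y x) {A : ℝ≥0} (hA : 1 ≤ A)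
    (htri : ∀ x y z, (G x y)⁻¹ ≤ A * max (G x z)⁻¹ (G z y)⁻¹) (x₀ x y z : Ω) :
    modifiedDist G x₀ x y ≤
      (A ^ 2 : ℝ≥0) * max (modifiedDist G x₀ x z) (modifiedDist G x₀ z y) := by
  have hA1 : (1 : ℝ≥0∞) ≤ A := by exact_mod_cast hA
  have hcancel : ∀ w, modifier G x₀ w * (modifier G x₀ w)⁻¹ = 1 := fun w =>
    ENNReal.mul_inv_cancel (modifier_ne_zero hG x₀ w) (modifier_ne_top G x₀ w)
  have hm : ∀ v w, (modifier G x₀ v)⁻¹ ≤ A * max (modifier G x₀ w)⁻¹ (G v w)⁻¹ := fun v w => by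
    rw [inv_modifier, inv_modifier]
    refine max_le ?_ ((htri v x₀ w).trans ?_)
    · exact one_le_mul hA1 ((le_max_left _ _).trans (le_max_left _ _))
    · exact mul_le_mul' le_rfl
        (max_le (le_max_right _ _) ((le_max_right _ _).trans (le_max_left _ _)))
  have key := mul_le_sq_mul_max (A := A) (p := (modifier G x₀ x)⁻¹) (r := (modifier G x₀ y)⁻¹)
    (s := (modifier G x₀ z)⁻¹) (htri x y z) ?_ ?_ ?_
  · set g := modifier G x₀
    calc modifiedDist G x₀ x y = g x * g y * (G x y)⁻¹ * (g z * (g z)⁻¹) := by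
          rw [hcancel, mul_one, modifiedDist]
      _ = g x * g y * g z * ((G x y)⁻¹ * (g z)⁻¹) := by ring
      _ ≤ g x * g y * g z * (A ^ 2 * max ((G x z)⁻¹ * (g y)⁻¹) ((G z y)⁻¹ * (g x)⁻¹)) := by gcongr
      _ = A ^ 2 * max (g x * g z * (G x z)⁻¹ * (g y * (g y)⁻¹))
            (g z * g y * (G z y)⁻¹ * (g x * (g x)⁻¹)) := by
          rw [mul_left_comm, mul_max]
          congr 2 <;> ring
      _ = _ := by rw [hcancel, hcancel, mul_one, mul_one]; push_cast; rfl
  · refine (htri x y x₀).trans ?_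
    rw [inv_modifier, inv_modifier, hsymm x₀ y]
    gcongr
    exacts [le_max_right _ _, le_max_right _ _]
  · rw [hsymm x z]
    exact hm z x
  · exact hm z y

theorem IsKernel.lowerSemicontinuous_right {Ω : Type*} [TopologicalSpace Ω] {G : Ω → Ω → ℝ≥0∞}
    (hG : IsKernel G) (x : Ω) : LowerSemicontinuous (G x) :=
  hG.lsc.comp (Continuous.prodMk_right x)

/-- Membership in the ball says that a continuous function of `y` is strictly below the lower
semicontinuous `G x y`, which is an open condition: take the union over intermediate values. -/
theorem isOpen_modifiedDist_lt {Ω : Type*} [TopologicalSpace Ω] {G : Ω → Ω → ℝ≥0∞}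
    (hG : IsKernel G) {x₀ : Ω} (hg : Continuous (modifier G x₀)) (x : Ω) (r : ℝ≥0) :
    IsOpen {y | modifiedDist G x₀ x y < r} := by
  rcases eq_or_ne r 0 with rfl | hr
  · simp
  have hr' : (r : ℝ≥0∞) ≠ 0 := by simpa using hr
  have hset : {y | modifiedDist G x₀ x y < r} = ⋃ a : ℝ≥0∞,
      {y | modifier G x₀ x * modifier G x₀ y / r < a} ∩ {y | a < G x y} := by
    ext y
    have : modifiedDist G x₀ x y < r ↔ modifier G x₀ x * modifier G x₀ y / r < G x y := by
      rw [modifiedDist, ← div_eq_mul_inv,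
        ENNReal.div_lt_iff (Or.inl (hG.pos x y).ne')
          (Or.inr (ENNReal.mul_ne_top (modifier_ne_top G x₀ x) (modifier_ne_top G x₀ y))),
        ENNReal.div_lt_iff (Or.inl hr') (Or.inl ENNReal.coe_ne_top), mul_comm (G x y)]
    simp only [Set.mem_ofPred_eq, Set.mem_iUnion, Set.mem_inter_iff, this]
    exact ⟨exists_between, fun ⟨a, h₁, h₂⟩ => h₁.trans h₂⟩
  rw [hset]
  refine isOpen_iUnion fun a => IsOpen.inter ?_ ((hG.lowerSemicontinuous_right x).isOpen_preimage a)
  refine isOpen_lt ?_ continuous_const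
  refine (ENNReal.continuous_div_const _ hr').comp ?_
  exact (ENNReal.continuous_const_mul (modifier_ne_top G x₀ x)).comp hg

end Sublinear

/-! ### Necessity: from a supersolution to the weighted norm inequality -/

namespace Sublinear

variable {Ω : Type*} [TopologicalSpace Ω] [MeasurableSpace Ω] [BorelSpace Ω]

theorem IsKernel.measurable_right {G : Ω → Ω → ℝ≥0∞} (hG : IsKernel G) (x : Ω) :
    Measurable (G x) :=
  (hG.lowerSemicontinuous_right x).measurable

theorem IsKernel.measurable_potential [SecondCountableTopology Ω] {G : Ω → Ω → ℝ≥0∞}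
    (hG : IsKernel G) (ν : Measure Ω) [SFinite ν] : Measurable (potential G ν) :=
  Measurable.lintegral_prod_right' hG.lsc.measurable

theorem potential_withDensity {G : Ω → Ω → ℝ≥0∞} (hG : IsKernel G) (ν : Measure Ω)
    {f : Ω → ℝ≥0∞} (hf : Measurable f) (x : Ω) :
    potential G (ν.withDensity f) x = ∫⁻ y, f y * G x y ∂ν := by
  rw [potential, lintegral_withDensity_eq_lintegral_mul _ hf (hG.measurable_right x)]
  rfl

/-- The modifier is dominated by `G(x, ·)` up to a finite constant. -/
theorem modifier_le_mul {Ω : Type*} [TopologicalSpace Ω] {G : Ω → Ω → ℝ≥0∞} (hG : IsKernel G)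
    (hqm : IsQuasiMetric G) (x₀ x : Ω) : ∃ C : ℝ≥0∞, C ≠ ∞ ∧ ∀ y, modifier G x₀ y ≤ C * G x y := by
  obtain ⟨A, hA, htri⟩ := hqm.exists_le_max
  have hmax : ∀ z, max 1 (G z x₀)⁻¹ ≠ ∞ := fun z => by
    rw [← inv_modifier]
    exact ENNReal.inv_ne_top.2 (modifier_ne_zero hG x₀ z)
  refine ⟨A * max 1 (G x x₀)⁻¹, ENNReal.mul_ne_top ENNReal.coe_ne_top (hmax x), fun y => ?_⟩
  -- With m = max(1, d(·, x₀)) one has d(x, y) ≤ A max(m(x), m(y)) ≤ A m(x) m(y), because both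
  -- factors are at least 1.
  have h : (G x y)⁻¹ ≤ A * max 1 (G x x₀)⁻¹ * (modifier G x₀ y)⁻¹ := by
    rw [inv_modifier]
    refine (htri x y x₀).trans ?_
    rw [hqm.1 x₀ y, mul_assoc]
    refine mul_le_mul' le_rfl (max_le ?_ ?_)
    · exact (le_max_right _ _).trans (le_mul_of_one_le_right zero_le (le_max_left _ _))
    · exact (le_max_right _ _).trans (le_mul_of_one_le_left zero_le (le_max_left _ _))
  rcases eq_or_ne (G x y) ∞ with hGt | hGt
  · rw [hGt, ENNReal.mul_top]
    · exact le_top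
    · refine mul_ne_zero (by exact_mod_cast (zero_lt_one.trans_le hA).ne') ?_
      exact (zero_lt_one.trans_le (le_max_left _ _)).ne'
  rw [← div_eq_mul_inv, ENNReal.le_div_iff_mul_le
    (Or.inl (modifier_ne_zero hG x₀ y)) (Or.inl (modifier_ne_top G x₀ y))] at h
  calc modifier G x₀ y = (G x y)⁻¹ * modifier G x₀ y * G x y := by
        rw [mul_right_comm, ENNReal.inv_mul_cancel (hG.pos x y).ne' hGt, one_mul]
    _ ≤ _ := by gcongr

/-- The potential of the modified kernel `1 / modifiedDist` against `g dτ`. -/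
theorem lintegral_inv_modifiedDist {G : Ω → Ω → ℝ≥0∞} (hG : IsKernel G) {x₀ : Ω}
    (hg : Continuous (modifier G x₀)) (τ : Measure Ω) (x : Ω) :
    ∫⁻ y, (modifiedDist G x₀ x y)⁻¹ ∂(τ.withDensity (modifier G x₀)) =
      (modifier G x₀ x)⁻¹ * potential G τ x := by
  have hinv : ∀ y, (modifiedDist G x₀ x y)⁻¹ =
      (modifier G x₀ x)⁻¹ * (modifier G x₀ y)⁻¹ * G x y := fun y => by
    rw [modifiedDist, ENNReal.mul_inv, ENNReal.mul_inv, inv_inv]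
    · exact Or.inl (modifier_ne_zero hG x₀ x)
    · exact Or.inl (modifier_ne_top G x₀ x)
    · exact Or.inr (ENNReal.inv_ne_top.2 (hG.pos x y).ne')
    · exact Or.inl (ENNReal.mul_ne_top (modifier_ne_top G x₀ x) (modifier_ne_top G x₀ y))
  simp only [hinv]
  have hm : Measurable fun y => (modifier G x₀ x)⁻¹ * (modifier G x₀ y)⁻¹ * G x y :=
    (hg.measurable.inv.const_mul _).mul (hG.measurable_right x)
  rw [lintegral_withDensity_eq_lintegral_mul _ hg.measurable hm, potential,
    ← lintegral_const_mul _ (hG.measurable_right x)]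
  refine lintegral_congr fun y => ?_
  calc modifier G x₀ y * ((modifier G x₀ x)⁻¹ * (modifier G x₀ y)⁻¹ * G x y)
      = modifier G x₀ y * (modifier G x₀ y)⁻¹ * ((modifier G x₀ x)⁻¹ * G x y) := by ring
    _ = _ := by
      rw [ENNReal.mul_inv_cancel (modifier_ne_zero hG x₀ y) (modifier_ne_top G x₀ y), one_mul]

/-- Weak-type estimate for quotients of potentials of a quasi-metric kernel. -/
theorem exists_weak_type_potential_le [LocallyCompactSpace Ω] [T2Space Ω]
    [SecondCountableTopology Ω] {G : Ω → Ω → ℝ≥0∞} (hG : IsKernel G) (hqm : IsQuasiMetric G)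
    {x₀ : Ω} (hg : Continuous (modifier G x₀)) {τ : Measure Ω}
    (hτ : ∫⁻ y, modifier G x₀ y ∂τ ≠ ∞) :
    ∃ B : ℝ≥0, 0 < B ∧ ∀ (ν : Measure Ω) (t : ℝ≥0∞),
      t * τ.withDensity (modifier G x₀) {x | t * potential G τ x < potential G ν x} ≤
        B * ∫⁻ y, modifier G x₀ y ∂ν := by
  obtain ⟨A, hA, htri⟩ := hqm.exists_le_max
  have : IsFiniteMeasure (τ.withDensity (modifier G x₀)) := isFiniteMeasure_withDensity hτ
  have hB : (0 : ℝ≥0) < 2 * (A ^ 2) ^ 2 := by positivity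
  -- The modified distance has quasi-triangle constant `A ^ 2`, so the covering enlarges radii by `2
  -- * (A ^ 2) ^ 2`.
  refine ⟨2 * (A ^ 2) ^ 2, hB, fun ν t => ?_⟩
  have hB0 : ((2 * (A ^ 2) ^ 2 : ℝ≥0) : ℝ≥0∞) ≠ 0 := ENNReal.coe_ne_zero.2 hB.ne'
  have key := measure_lt_potential_le (modifiedDist_comm hqm.1 x₀) (one_le_pow₀ hA : 1 ≤ A ^ 2)
    (modifiedDist_le hG hqm.1 hA htri x₀) (isOpen_modifiedDist_lt hG hg)
    (ν := ν.withDensity (modifier G x₀)) (ω := τ.withDensity (modifier G x₀))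
    (t / (2 * (A ^ 2) ^ 2 : ℝ≥0))
  simp only [lintegral_inv_modifiedDist hG hg] at key
  rw [withDensity_apply _ MeasurableSet.univ, Measure.restrict_univ] at key
  -- The factor `(modifier G x₀ x)⁻¹` is common to both modified potentials and cancels.
  have hset : ∀ x, t / (2 * (A ^ 2) ^ 2 : ℝ≥0) * ((2 * (A ^ 2) ^ 2 : ℝ≥0) *
      ((modifier G x₀ x)⁻¹ * potential G τ x)) < (modifier G x₀ x)⁻¹ * potential G ν x ↔
      t * potential G τ x < potential G ν x := fun x => by
    rw [← mul_assoc, ENNReal.div_mul_cancel hB0 ENNReal.coe_ne_top, mul_left_comm]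
    exact ENNReal.mul_lt_mul_iff_right (ENNReal.inv_ne_zero.2 (modifier_ne_top G x₀ x))
      (ENNReal.inv_ne_top.2 (modifier_ne_zero hG x₀ x))
  simp only [hset] at key
  calc t * τ.withDensity (modifier G x₀) {x | t * potential G τ x < potential G ν x}
      = (2 * (A ^ 2) ^ 2 : ℝ≥0) * (t / (2 * (A ^ 2) ^ 2 : ℝ≥0) *
        τ.withDensity (modifier G x₀) {x | t * potential G τ x < potential G ν x}) := by
        rw [← mul_assoc, ENNReal.mul_div_cancel hB0 ENNReal.coe_ne_top]
    _ ≤ _ := by gcongr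

theorem eLpNorm_ofReal_eq {α : Type*} [MeasurableSpace α] {q : ℝ} (hq : 0 < q) (f : α → ℝ≥0∞)
    (σ : Measure α) :
    eLpNorm f (ENNReal.ofReal q) σ = (∫⁻ x, f x ^ q ∂σ) ^ (1 / q) := by
  rw [eLpNorm_eq_lintegral_rpow_enorm_toReal (by simpa using hq) ENNReal.ofReal_ne_top,
    ENNReal.toReal_ofReal hq.le]
  simp only [enorm_eq_self]

/-- A nontrivial supersolution yields the weighted norm inequality. -/
theorem IsNontrivialSupersolution.finite_and_leastConstant_lt_top [LocallyCompactSpace Ω]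
    [T2Space Ω] [SecondCountableTopology Ω] {G : Ω → Ω → ℝ≥0∞} (hG : IsKernel G)
    (hqm : IsQuasiMetric G) {x₀ : Ω} (hg : Continuous (modifier G x₀)) {μ σ : Measure Ω}
    (hσ : σ ≠ 0) {q : ℝ} (hq₀ : 0 < q) (hq₁ : q < 1) {u : Ω → ℝ≥0∞}
    (hu : IsNontrivialSupersolution G q σ μ u) :
    ∫⁻ x, modifier G x₀ x ∂μ < ∞ ∧ leastConstant G q σ (modifier G x₀) < ∞ := by
  have hgm := hg.measurable
  have huq : Measurable fun y => u y ^ q := hu.measurable.pow_const q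
  set τ := σ.withDensity fun y => u y ^ q with hτdef
  have : (ae σ).NeBot := ae_neBot.2 hσ
  obtain ⟨x, hx⟩ := (hu.rhs_le.and hu.lt_top).exists
  have hfin : potential G τ x + potential G μ x < ∞ := hx.1.trans_lt hx.2
  obtain ⟨C, hC, hCg⟩ := modifier_le_mul hG hqm x₀ x
  have hdom : ∀ ν : Measure Ω, potential G ν x < ∞ → ∫⁻ y, modifier G x₀ y ∂ν < ∞ := by
    intro ν hν
    calc ∫⁻ y, modifier G x₀ y ∂ν ≤ ∫⁻ y, C * G x y ∂ν := lintegral_mono hCg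
      _ = C * potential G ν x := lintegral_const_mul _ (hG.measurable_right x)
      _ < ∞ := ENNReal.mul_lt_top hC.lt_top hν
  have hτ := hdom τ ((le_add_right le_rfl).trans_lt hfin)
  refine ⟨hdom μ ((le_add_left le_rfl).trans_lt hfin), ?_⟩
  obtain ⟨B, hB, hweak⟩ := exists_weak_type_potential_le hG hqm hg hτ.ne
  have hB0 : (B : ℝ≥0∞) ≠ 0 := ENNReal.coe_ne_zero.2 hB.ne'
  -- Kolmogorov's constant for the finite measure g dτ. It does not depend on `ν`, and `q < 1` makes
  -- it finite.
  set D : ℝ≥0∞ := τ.withDensity (modifier G x₀) Set.univ + 2 ^ q * (1 - 2 ^ (q - 1))⁻¹ with hD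
  have hDtop : D ≠ ∞ := by
    refine ENNReal.add_ne_top.2 ⟨?_, ENNReal.mul_ne_top ?_ ?_⟩
    · rw [withDensity_apply _ MeasurableSet.univ, Measure.restrict_univ]
      exact hτ.ne
    · exact ENNReal.rpow_ne_top_of_nonneg hq₀.le ENNReal.ofNat_ne_top
    · refine ENNReal.inv_ne_top.2 (tsub_pos_of_lt ?_).ne'
      exact ENNReal.rpow_lt_one_of_one_lt_of_neg ENNReal.one_lt_two (by linarith)
  have hD0 : D ≠ 0 := by
    refine fun h0 => mul_ne_zero ?_ ?_ (add_eq_zero.1 h0).2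
    · exact (ENNReal.rpow_pos two_pos ENNReal.ofNat_ne_top).ne'
    · exact ENNReal.inv_ne_zero.2 (ENNReal.sub_ne_top ENNReal.one_ne_top)
  have hDq0 : D ^ (1 / q) ≠ 0 := (ENNReal.rpow_pos (pos_iff_ne_zero.2 hD0) hDtop).ne'
  refine lt_of_le_of_lt (sInf_le (a := B * D ^ (1 / q)) fun ν hν => ?_)
    (ENNReal.mul_lt_top ENNReal.coe_lt_top
      (ENNReal.rpow_lt_top_of_nonneg (by positivity) hDtop))
  rw [eLpNorm_ofReal_eq hq₀]
  have hmν := hG.measurable_potential ν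
  set N := ∫⁻ y, modifier G x₀ y ∂ν with hN
  rcases eq_or_ne N ∞ with hNt | hNt
  · rw [hNt, ENNReal.mul_top (mul_ne_zero hB0 hDq0)]
    exact le_top
  rcases eq_or_ne N 0 with hN0 | hN0
  · have hν0 : ν = 0 := by
      rw [hN, lintegral_eq_zero_iff hgm] at hN0
      by_contra hne
      have : (ae ν).NeBot := ae_neBot.2 hne
      obtain ⟨y, hy⟩ := hN0.exists
      exact modifier_ne_zero hG x₀ y hy
    simp [hν0, potential, hq₀]
  have hM0 : B * N ≠ 0 := mul_ne_zero hB0 hN0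
  have hMt : B * N ≠ ∞ := ENNReal.mul_ne_top ENNReal.coe_ne_top hNt
  have hac : τ.withDensity (modifier G x₀) ≪ σ :=
    (withDensity_absolutelyContinuous _ _).trans (withDensity_absolutelyContinuous _ _)
  have hFm : Measurable fun y => potential G ν y / u y := hmν.div hu.measurable
  have hkol := lintegral_rpow_le_of_weak_type (ω := τ.withDensity (modifier G x₀)) hFm hq₀ hM0
    hMt fun t => by
      refine le_trans ?_ (hweak ν t)
      gcongr t * ?_
      refine measure_mono_ae ?_
      filter_upwards [hac.ae_le hu.rhs_le, hac.ae_le hu.pos, hac.ae_le hu.lt_top]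
        with y hy hy0 hyt hty
      have hty' : t < potential G ν y / u y := hty
      rw [ENNReal.lt_div_iff_mul_lt (Or.inl hy0.ne') (Or.inl hyt.ne)] at hty'
      exact lt_of_le_of_lt (by gcongr; exact (le_add_right le_rfl).trans hy) hty'
  -- The density `u ^ q` of `τ` cancels the denominator, as `0 < u < ∞` almost everywhere.
  have hint : ∫⁻ y, potential G ν y ^ q ∂(σ.withDensity (modifier G x₀)) =
      ∫⁻ y, (potential G ν y / u y) ^ q ∂(τ.withDensity (modifier G x₀)) := by
    rw [lintegral_withDensity_eq_lintegral_mul _ hgm (hmν.pow_const q),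
      lintegral_withDensity_eq_lintegral_mul _ hgm (hFm.pow_const q),
      lintegral_withDensity_eq_lintegral_mul _ huq (hgm.mul (hFm.pow_const q))]
    refine lintegral_congr_ae ?_
    filter_upwards [hu.pos, hu.lt_top] with y hy0 hyt
    simp only [Pi.mul_apply]
    rw [mul_left_comm, ← ENNReal.mul_rpow_of_nonneg _ _ hq₀.le,
      ENNReal.mul_div_cancel hy0.ne' hyt.ne]
  calc (∫⁻ y, potential G ν y ^ q ∂(σ.withDensity (modifier G x₀))) ^ (1 / q)
      ≤ ((B * N) ^ q * D) ^ (1 / q) := by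
        rw [hint]
        exact ENNReal.rpow_le_rpow hkol (by positivity)
    _ = B * D ^ (1 / q) * N := by
        rw [ENNReal.mul_rpow_of_nonneg _ _ (by positivity), ← ENNReal.rpow_mul,
          mul_one_div_cancel hq₀.ne', ENNReal.rpow_one]
        ring

end Sublinear

/-! ### Sufficiency: monotone iteration -/

namespace Sublinear

variable {Ω : Type*} [TopologicalSpace Ω] [MeasurableSpace Ω] [BorelSpace Ω]

/-- Markov's inequality on the neighbourhood of `x` where `g` exceeds half its value at `x`. It
makes the measures met in the iteration admissible in the weighted norm inequality. -/
theorem isLocallyFiniteMeasure_of_lintegral_ne_top {τ : Measure Ω} {g : Ω → ℝ≥0∞}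
    (hg : Continuous g) (hg0 : ∀ x, g x ≠ 0) (hgt : ∀ x, g x ≠ ∞) (h : ∫⁻ x, g x ∂τ ≠ ∞) :
    IsLocallyFiniteMeasure τ := by
  refine ⟨fun x => ⟨{y | g x / 2 < g y}, ?_, ?_⟩⟩
  · exact (isOpen_lt continuous_const hg).mem_nhds (ENNReal.half_lt_self (hg0 x) (hgt x))
  · refine (measure_mono fun y (hy : g x / 2 < g y) => hy.le).trans_lt
      ((meas_ge_le_lintegral_div hg.measurable.aemeasurable (ENNReal.half_pos (hg0 x)).ne'
        (ENNReal.div_lt_top (hgt x) two_ne_zero).ne).trans_lt ?_)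
    exact ENNReal.div_lt_top h (ENNReal.half_pos (hg0 x)).ne'

theorem rhs_eq {G : Ω → Ω → ℝ≥0∞} (hG : IsKernel G) (q : ℝ) (σ μ : Measure Ω) {u : Ω → ℝ≥0∞}
    (hu : Measurable u) (x : Ω) :
    rhs G q σ μ u x = ∫⁻ y, u y ^ q * G x y ∂σ + potential G μ x := by
  rw [rhs, potential_withDensity hG σ (hu.pow_const q)]

theorem rhs_mono {G : Ω → Ω → ℝ≥0∞} (hG : IsKernel G) {q : ℝ} (hq : 0 ≤ q) (σ μ : Measure Ω)
    {u v : Ω → ℝ≥0∞} (hu : Measurable u) (hv : Measurable v) (huv : u ≤ v) :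
    rhs G q σ μ u ≤ rhs G q σ μ v := fun x => by
  rw [rhs_eq hG q σ μ hu, rhs_eq hG q σ μ hv]
  gcongr with y
  exact huv y

theorem measurable_rhs [SecondCountableTopology Ω] {G : Ω → Ω → ℝ≥0∞} (hG : IsKernel G) (q : ℝ)
    (σ μ : Measure Ω) [SFinite σ] [SFinite μ] (u : Ω → ℝ≥0∞) : Measurable (rhs G q σ μ u) :=
  (hG.measurable_potential _).add (hG.measurable_potential μ)

theorem rhs_iSup {G : Ω → Ω → ℝ≥0∞} (hG : IsKernel G) {q : ℝ} (hq : 0 < q)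
    (σ μ : Measure Ω) {v : ℕ → Ω → ℝ≥0∞} (hv : ∀ n, Measurable (v n)) (hmono : Monotone v)
    (x : Ω) : rhs G q σ μ (fun y => ⨆ n, v n y) x = ⨆ n, rhs G q σ μ (v n) x := by
  have hpow : ∀ y, (⨆ n, v n y) ^ q = ⨆ n, v n y ^ q := fun y =>
    (ENNReal.orderIsoRpow q hq).map_iSup _
  rw [rhs_eq hG q σ μ (.iSup hv)]
  simp only [rhs_eq hG q σ μ (hv _), hpow, ENNReal.iSup_mul, ← ENNReal.iSup_add]
  have hm : ∀ n, Measurable fun y => v n y ^ q * G x y := fun n =>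
    ((hv n).pow_const q).mul (hG.measurable_right x)
  rw [lintegral_iSup hm]
  intro m n hmn y
  dsimp only
  gcongr
  exact hmono hmn y

/-- Some multiple of the indicator of a set of positive measure is a subsolution. -/
theorem exists_indicator_le_rhs [SigmaCompactSpace Ω] [T2Space Ω] {G : Ω → Ω → ℝ≥0∞}
    (hG : IsKernel G) {q : ℝ} (hq₁ : q < 1) (σ μ : Measure Ω)
    [IsLocallyFiniteMeasure σ] (hσ : σ ≠ 0) :
    ∃ (F : Set Ω) (ε : ℝ≥0∞), MeasurableSet F ∧ σ F ≠ 0 ∧ σ F ≠ ∞ ∧ ε ≠ 0 ∧ ε ≠ ∞ ∧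
      F.indicator (fun _ => ε) ≤ rhs G q σ μ (F.indicator fun _ => ε) := by
  obtain ⟨n, hn⟩ : ∃ n, σ (compactCovering Ω n) ≠ 0 := by
    by_contra! hcon
    refine hσ (Measure.measure_univ_eq_zero.1 ?_)
    rw [← iUnion_compactCovering Ω]
    exact measure_iUnion_null hcon
  have hFc := isCompact_compactCovering Ω n
  set F := compactCovering Ω n
  have hFm : MeasurableSet F := hFc.measurableSet
  obtain ⟨c, hc0, hc⟩ : ∃ c : ℝ≥0∞, c ≠ 0 ∧ ∀ x ∈ F, ∀ y ∈ F, c ≤ G x y := by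
    have hne : (F ×ˢ F).Nonempty := by
      have : F.Nonempty := nonempty_of_measure_ne_zero hn
      exact this.prod this
    obtain ⟨p, -, hp⟩ := (hG.lsc.lowerSemicontinuousOn (F ×ˢ F)).exists_isMinOn hne
      (hFc.prod hFc)
    exact ⟨G p.1 p.2, (hG.pos _ _).ne', fun x hx y hy => hp (Set.mk_mem_prod hx hy)⟩
  -- A value `ε` with `ε ^ (1 - q) ≤ c * σ F` is wanted. The truncation at `1` keeps it finite,
  -- since `c` may be `∞`.
  set b := min 1 (c * σ F) with hb
  have hb0 : b ≠ 0 := (lt_min zero_lt_one (ENNReal.mul_pos hc0 hn)).ne'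
  have hbt : b ≠ ∞ := ne_top_of_le_ne_top ENNReal.one_ne_top (min_le_left _ _)
  have h1q : 0 < 1 - q := by linarith
  set ε := b ^ (1 / (1 - q)) with hε
  have hε0 : ε ≠ 0 := (ENNReal.rpow_pos (pos_iff_ne_zero.2 hb0) hbt).ne'
  have hεt : ε ≠ ∞ := ENNReal.rpow_ne_top_of_nonneg (by positivity) hbt
  have hεb : ε = ε ^ q * b := by
    have h1 : ε ^ (1 - q) = b := by
      rw [hε, ← ENNReal.rpow_mul, one_div_mul_cancel h1q.ne', ENNReal.rpow_one]
    calc ε = ε ^ (q + (1 - q)) := by rw [add_sub_cancel, ENNReal.rpow_one]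
      _ = ε ^ q * b := by rw [ENNReal.rpow_add _ _ hε0 hεt, h1]
  refine ⟨F, ε, hFm, hn, hFc.measure_lt_top.ne, hε0, hεt, fun x => ?_⟩
  by_cases hx : x ∈ F
  swap
  · simp [hx]
  rw [Set.indicator_of_mem hx, rhs_eq hG q σ μ (measurable_const.indicator hFm)]
  calc ε = ε ^ q * b := hεb
    _ ≤ ε ^ q * (c * σ F) := by gcongr; exact min_le_right _ _
    _ = ∫⁻ _ in F, ε ^ q * c ∂σ := by rw [setLIntegral_const, mul_assoc]
    _ ≤ ∫⁻ y in F, F.indicator (fun _ => ε) y ^ q * G x y ∂σ := by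
        refine setLIntegral_mono' hFm fun y hy => ?_
        rw [Set.indicator_of_mem hy]
        gcongr
        exact hc x hx y hy
    _ ≤ ∫⁻ y, F.indicator (fun _ => ε) y ^ q * G x y ∂σ := setLIntegral_le_lintegral _ _
    _ ≤ _ := le_add_right le_rfl

/-- A sublinear recursion stays bounded. -/
theorem exists_bound_of_sublinear {q : ℝ} (hq₁ : q < 1) {K B a : ℝ≥0∞}
    (hK : K ≠ ∞) (hB : B ≠ ∞) (ha : a ≠ ∞) :
    ∃ M : ℝ≥0∞, M ≠ ∞ ∧ a ≤ M ∧ K * M ^ q + B ≤ M := by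
  have h1q : 0 < 1 - q := by linarith
  set L := (2 * K) ^ (1 / (1 - q)) with hL
  have hLt : L ≠ ∞ := ENNReal.rpow_ne_top_of_nonneg (by positivity)
    (ENNReal.mul_ne_top ENNReal.ofNat_ne_top hK)
  -- `M ≥ L` makes `K * M ^ q` at most half of `M`, and `2 * B` accounts for the other half; the `1`
  -- only ensures `M ≠ 0`.
  set M := L + 2 * B + a + 1 with hM
  have hMt : M ≠ ∞ := by
    simp [hM, hLt, hB, ha, ENNReal.mul_eq_top]
  have hM0 : M ≠ 0 := by simp [hM]
  have hLM : L ≤ M := by rw [hM, add_assoc, add_assoc]; exact le_self_add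
  have hBM : 2 * B ≤ M := by rw [hM, add_comm L, add_assoc, add_assoc]; exact le_self_add
  refine ⟨M, hMt, by rw [hM, add_right_comm]; exact le_add_self, ?_⟩
  have hK2 : 2 * K * M ^ q ≤ M := by
    calc 2 * K * M ^ q = L ^ (1 - q) * M ^ q := by
          rw [hL, ← ENNReal.rpow_mul, one_div_mul_cancel h1q.ne', ENNReal.rpow_one]
      _ ≤ M ^ (1 - q) * M ^ q := by gcongr
      _ = M := by
          rw [← ENNReal.rpow_add _ _ hM0 hMt, sub_add_cancel, ENNReal.rpow_one]
  refine (ENNReal.mul_le_mul_iff_right two_ne_zero ENNReal.ofNat_ne_top).1 ?_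
  calc 2 * (K * M ^ q + B) = 2 * K * M ^ q + 2 * B := by ring
    _ ≤ M + M := add_le_add hK2 hBM
    _ = 2 * M := (two_mul M).symm

/-- The weighted norm inequality yields a nontrivial solution, by monotone iteration. -/
theorem exists_isNontrivialSolution [LocallyCompactSpace Ω] [T2Space Ω]
    [SecondCountableTopology Ω] {G : Ω → Ω → ℝ≥0∞} (hG : IsKernel G) {x₀ : Ω}
    (hg : Continuous (modifier G x₀)) {μ σ : Measure Ω} [IsLocallyFiniteMeasure μ]
    [IsLocallyFiniteMeasure σ] (hσ : σ ≠ 0) {q : ℝ} (hq₀ : 0 < q) (hq₁ : q < 1)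
    (hμ : ∫⁻ x, modifier G x₀ x ∂μ < ∞) (hC : leastConstant G q σ (modifier G x₀) < ∞) :
    ∃ u, IsNontrivialSolution G q σ μ u := by
  have hgm := hg.measurable
  obtain ⟨C, hCmem, hCt⟩ := sInf_lt_iff.1 hC
  have hineq : ∀ ν : Measure Ω, IsLocallyFiniteMeasure ν →
      ∫⁻ x, potential G ν x ^ q ∂(σ.withDensity (modifier G x₀)) ≤
        C ^ q * (∫⁻ y, modifier G x₀ y ∂ν) ^ q := fun ν hν => by
    have h := hCmem ν hν
    rw [eLpNorm_ofReal_eq hq₀, one_div, ENNReal.rpow_inv_le_iff hq₀,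
      ENNReal.mul_rpow_of_nonneg _ _ hq₀.le] at h
    exact h
  obtain ⟨F, ε, hFm, hF0, hFt, hε0, hεt, hsub⟩ := exists_indicator_le_rhs hG hq₁ σ μ hσ
  let v : ℕ → Ω → ℝ≥0∞ := fun n => (rhs G q σ μ)^[n] (F.indicator fun _ => ε)
  have hv_succ : ∀ n, v (n + 1) = rhs G q σ μ (v n) := fun n =>
    Function.iterate_succ_apply' _ _ _
  have hvm : ∀ n, Measurable (v n) := fun n => by
    cases n with
    | zero => exact measurable_const.indicator hFm
    | succ n => rw [hv_succ]; exact measurable_rhs hG q σ μ _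
  have hmono : Monotone v := monotone_nat_of_le_succ fun n => by
    induction n with
    | zero => rw [hv_succ]; exact hsub
    | succ n ih =>
      rw [hv_succ (n + 1)]
      conv_lhs => rw [hv_succ n]
      exact rhs_mono hG hq₀.le σ μ (hvm _) (hvm _) ih
  have ha : ∫⁻ x, v 0 x ^ q ∂(σ.withDensity (modifier G x₀)) ≠ ∞ := by
    have hv0 : ∀ x, v 0 x ^ q = F.indicator (fun _ => ε ^ q) x := fun x => by
      by_cases hx : x ∈ F <;> simp [v, hx, hq₀]
    simp only [hv0]
    rw [lintegral_indicator_const hFm, withDensity_apply _ hFm]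
    refine ENNReal.mul_ne_top (ENNReal.rpow_ne_top_of_nonneg hq₀.le hεt)
      (ne_top_of_le_ne_top hFt ?_)
    calc ∫⁻ x in F, modifier G x₀ x ∂σ ≤ ∫⁻ _ in F, 1 ∂σ :=
          lintegral_mono fun x => modifier_le_one G x₀ x
      _ = σ F := setLIntegral_one F
  obtain ⟨M, hMt, haM, hM⟩ := exists_bound_of_sublinear hq₁ (K := C ^ q)
    (B := C ^ q * (∫⁻ x, modifier G x₀ x ∂μ) ^ q)
    (ENNReal.rpow_ne_top_of_nonneg hq₀.le hCt.ne)
    (ENNReal.mul_ne_top (ENNReal.rpow_ne_top_of_nonneg hq₀.le hCt.ne)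
      (ENNReal.rpow_ne_top_of_nonneg hq₀.le hμ.ne)) ha
  have hbound : ∀ n, ∫⁻ x, v n x ^ q ∂(σ.withDensity (modifier G x₀)) ≤ M := by
    intro n
    induction n with
    | zero => exact haM
    | succ n ih =>
      -- The g-mass of `v n ^ q` dσ, which enters the right side of the norm inequality, is the very
      -- integral being bounded; this closes the induction.
      have hswap : ∫⁻ y, modifier G x₀ y ∂(σ.withDensity fun y => v n y ^ q) =
          ∫⁻ x, v n x ^ q ∂(σ.withDensity (modifier G x₀)) := by
        rw [lintegral_withDensity_eq_lintegral_mul _ ((hvm n).pow_const q) hgm,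
          lintegral_withDensity_eq_lintegral_mul _ hgm ((hvm n).pow_const q), mul_comm]
      have hlf : IsLocallyFiniteMeasure (σ.withDensity fun y => v n y ^ q) :=
        isLocallyFiniteMeasure_of_lintegral_ne_top hg (modifier_ne_zero hG x₀)
          (modifier_ne_top G x₀) (by rw [hswap]; exact ne_top_of_le_ne_top hMt ih)
      calc ∫⁻ x, v (n + 1) x ^ q ∂(σ.withDensity (modifier G x₀))
          ≤ ∫⁻ x, (potential G (σ.withDensity fun y => v n y ^ q) x ^ q + potential G μ x ^ q)
              ∂(σ.withDensity (modifier G x₀)) := by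
            refine lintegral_mono fun x => ?_
            rw [hv_succ]
            exact ENNReal.rpow_add_le_add_rpow _ _ hq₀.le hq₁.le
        _ = ∫⁻ x, potential G (σ.withDensity fun y => v n y ^ q) x ^ q
              ∂(σ.withDensity (modifier G x₀)) +
            ∫⁻ x, potential G μ x ^ q ∂(σ.withDensity (modifier G x₀)) :=
            lintegral_add_left ((hG.measurable_potential _).pow_const q) _
        _ ≤ C ^ q * M ^ q + C ^ q * (∫⁻ x, modifier G x₀ x ∂μ) ^ q := by
            refine add_le_add ((hineq _ hlf).trans ?_) (hineq μ inferInstance)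
            rw [hswap]
            gcongr
        _ ≤ M := hM
  let u : Ω → ℝ≥0∞ := fun x => ⨆ n, v n x
  have hum : Measurable u := .iSup hvm
  have hsol : ∀ x, u x = rhs G q σ μ u x := fun x => by
    rw [rhs_iSup hG hq₀ σ μ hvm hmono]
    refine le_antisymm (iSup_le fun n => ?_) (iSup_le fun n => ?_)
    · refine le_iSup_of_le n ?_
      rw [← hv_succ]
      exact hmono n.le_succ x
    · rw [← hv_succ]
      exact le_iSup (fun k => v k x) (n + 1)
  -- `u ≥ ε` on `F`, which has positive `σ`-measure, and `G > 0`: the potential term is positive at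
  -- every point, also off `F`.
  have hpos : ∀ x, 0 < u x := fun x => by
    rw [hsol, rhs_eq hG q σ μ hum]
    refine lt_of_lt_of_le ?_ (le_add_right le_rfl)
    have hm : Measurable fun y => u y ^ q * G x y := (hum.pow_const q).mul (hG.measurable_right x)
    rw [lintegral_pos_iff_support hm]
    refine (pos_iff_ne_zero.2 hF0).trans_le (measure_mono fun y hy => ?_)
    refine mul_ne_zero ?_ (hG.pos x y).ne'
    have h1 : ε ≤ u y := le_iSup_of_le 0 (by simp [v, hy])
    have h2 : 0 < u y := (pos_iff_ne_zero.2 hε0).trans_le h1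
    simp [h2.ne', hq₀.not_gt]
  have hfin : ∀ᵐ x ∂σ, u x < ∞ := by
    have hle : ∫⁻ x, u x ^ q ∂(σ.withDensity (modifier G x₀)) ≤ M := by
      have hpow : ∀ x, u x ^ q = ⨆ n, v n x ^ q := fun x =>
        (ENNReal.orderIsoRpow q hq₀).map_iSup _
      simp only [hpow]
      rw [lintegral_iSup fun n => (hvm n).pow_const q]
      · exact iSup_le hbound
      · intro m n hmn x
        exact ENNReal.rpow_le_rpow (hmono hmn x) hq₀.le
    have hae := ae_lt_top (hum.pow_const q) (ne_top_of_le_ne_top hMt hle)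
    rw [ae_withDensity_iff hgm] at hae
    filter_upwards [hae] with x hx
    exact (ENNReal.rpow_lt_top_iff_of_pos hq₀).1 (hx (modifier_ne_zero hG x₀ x))
  refine ⟨u, ⟨hum, .of_forall fun x => (hsol x).le, ?_⟩, ⟨hum, .of_forall hpos,
    .of_forall fun x => (hsol x).ge, hfin⟩⟩
  filter_upwards [hfin] with x hx
  rwa [← hsol]

end Sublinear

theorem corollary5p5 {Ω : Type*} [TopologicalSpace Ω] [LocallyCompactSpace Ω] [T2Space Ω]
    [SecondCountableTopology Ω] [MeasurableSpace Ω] [BorelSpace Ω]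
    (G : Ω → Ω → ℝ≥0∞) (hG : Sublinear.IsKernel G) (hGqm : Sublinear.IsQuasiMetric G)
    (x₀ : Ω) (hg : Continuous (Sublinear.modifier G x₀))
    (μ σ : Measure Ω) [IsLocallyFiniteMeasure μ] [IsLocallyFiniteMeasure σ] (hσ : σ ≠ 0)
    (q : ℝ) (hq₀ : 0 < q) (hq₁ : q < 1) :
    ((∃ u : Ω → ℝ≥0∞, Sublinear.IsNontrivialSupersolution G q σ μ u) ↔
      ((∫⁻ x, Sublinear.modifier G x₀ x ∂μ) < ∞ ∧
        Sublinear.leastConstant G q σ (Sublinear.modifier G x₀) < ∞)) ∧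
    ((∃ u : Ω → ℝ≥0∞, Sublinear.IsNontrivialSolution G q σ μ u) ↔
      ((∫⁻ x, Sublinear.modifier G x₀ x ∂μ) < ∞ ∧
        Sublinear.leastConstant G q σ (Sublinear.modifier G x₀) < ∞)) := by
  have h_nec : ∀ u, Sublinear.IsNontrivialSupersolution G q σ μ u → _ := fun u hu =>
    hu.finite_and_leastConstant_lt_top hG hGqm hg hσ hq₀ hq₁
  have h_suff := fun h : (∫⁻ x, Sublinear.modifier G x₀ x ∂μ) < ∞ ∧
      Sublinear.leastConstant G q σ (Sublinear.modifier G x₀) < ∞ =>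
    Sublinear.exists_isNontrivialSolution hG hg hσ hq₀ hq₁ h.1 h.2
  exact ⟨⟨fun ⟨u, hu⟩ => h_nec u hu, fun h => (h_suff h).imp fun _ hu => hu.2⟩,
    ⟨fun ⟨u, hu⟩ => h_nec u hu.2, h_suff⟩⟩
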